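/- Let $\xi$ be a real random variable with $\mathbb{E}\,\xi=0$, $\mathbb{E}\,\xi^2=1$ and $\mathbb{E}\,\xi^4<\infty$, and let $(\xi_{i,j})_{i,j=1}^{\infty}$ be independent copies of $\xi$. For every $d\in\mathbb{N}$ consider the random walk in $\mathbb{R}^d$ given by $$ X_i^{(d)}:=\frac{(\xi_{i,1},\dots,\xi_{i,d})}{\sqrt d},\qquad S_0^{(d)}:=0,\qquad S_k^{(d)}:=X_1^{(d)}+\dots+X_k^{(d)},\quad k\in\mathbb{N}, $$ and let $\|\cdot\|$ denote the Euclidean norm. Then, for every sequence $n=n(d)$ of positive integers such that $n(d)\to\infty$ as $d\to\infty$, $$ \frac{\|S_{n}^{(d)}\|^2-n}{\sqrt{2n^2/d}}\;\longrightarrow\;\mathrm{N}(0,1)\qquad\text{in distribution, as } d\to\infty, $$ where $\mathrm{N}(0,1)$ is the standard normal distribution. -/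

import Mathlib

open MeasureTheory ProbabilityTheory Filter

noncomputable section

/-- The `i`-th increment of the `d`-dimensional walk, `X_i^{(d)} = (ξ_{i,1}, …, ξ_{i,d}) / √d`, as a
random vector in Euclidean space. Rows and columns of the array `ξ` are numbered from `0`. -/
def walkIncrement {Ω : Type*} (ξ : ℕ → ℕ → Ω → ℝ) (d i : ℕ) (ω : Ω) : EuclideanSpace ℝ (Fin d) :=
  (√(d : ℝ))⁻¹ • WithLp.toLp 2 (fun j : Fin d => ξ i j ω)

/-- The `d`-dimensional random walk after `k` steps: the sum of its first `k` increments. -/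
def walkPosition {Ω : Type*} (ξ : ℕ → ℕ → Ω → ℝ) (d k : ℕ) (ω : Ω) : EuclideanSpace ℝ (Fin d) :=
  ∑ i ∈ Finset.range k, walkIncrement ξ d i ω

end

/-! With `S_{m,j} = ∑_{i < m} ξ i j` and `W_{m,j} = (S_{m,j} ^ 2 - m) / (√2 m)`, the normalized
squared norm of the walk after `n` steps is `d^{-1/2} ∑_{j < d} W_{n,j}`, a normalized sum of i.i.d.
terms whose common law depends on `d` through `n = n(d)`.

The classical central limit theorem gives `W_{m,0} ⇒ (g ^ 2 - 1) / √2` with `g` standard Gaussian.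
The fourth cumulant `κ₄` is additive over independent summands, so
`E W_{m,0} ^ 2 = 1 + κ₄(ξ) / (2 m) → 1`. This is the second moment of the limit: a Gaussian is
stable under sums, hence `2 κ₄(g) = κ₄(g₁ + g₂) = κ₄(√2 g) = 4 κ₄(g)` and `κ₄(g) = 0`. Convergence
in law together with convergence of second moments yields the Lindeberg-type condition
`E W_{n,0} ^ 2 min(1, |s_d W_{n,0}|) → 0` whenever `s_d → 0`. With `s_d = t / √d` it bounds the
error of the second-order Taylor expansion of the characteristic function by `o(1 / d)`, which
survives the `d`-th power. -/

open scoped Topology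

lemma norm_exp_mul_I_sub_taylor_two_le (x : ℝ) :
    ‖Complex.exp (x * Complex.I) - (1 + x * Complex.I - (x : ℂ) ^ 2 / 2)‖
      ≤ 4 * (x ^ 2 * min 1 |x|) := by
  rcases le_total |x| 1 with h | h
  · have htaylor : ∑ m ∈ Finset.range 3, (x * Complex.I) ^ m / (m.factorial : ℂ)
        = 1 + x * Complex.I - (x : ℂ) ^ 2 / 2 := by
      simp [Finset.sum_range_succ, mul_pow, Nat.factorial]
      ring
    have hbound := Complex.exp_bound (x := x * Complex.I) (by simpa using h) (n := 3) (by norm_num)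
    have hcube : 0 ≤ |x| ^ 3 := by positivity
    rw [htaylor, norm_mul, Complex.norm_I, mul_one, Complex.norm_real, Real.norm_eq_abs] at hbound
    norm_num [Nat.factorial] at hbound
    rw [min_eq_right h, ← sq_abs x, ← pow_succ]
    linarith
  · have hbound : ‖Complex.exp (x * Complex.I) - (1 + x * Complex.I - (x : ℂ) ^ 2 / 2)‖
        ≤ 1 + (1 + |x| + x ^ 2 / 2) := by
      refine (norm_sub_le _ _).trans (add_le_add (Complex.norm_exp_ofReal_mul_I x).le ?_)
      refine (norm_sub_le _ _).trans (add_le_add ((norm_add_le _ _).trans ?_) ?_) <;> simp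
    rw [min_eq_left h, mul_one]
    nlinarith [sq_abs x]

section SecondMoment

lemma integrable_sq_mul_min {μ : Measure ℝ} (hμ : MemLp id 2 μ) (s : ℝ) :
    Integrable (fun x : ℝ => x ^ 2 * min 1 |s * x|) μ := by
  refine hμ.integrable_sq.mono' (by fun_prop) (ae_of_all _ fun x => ?_)
  rw [Real.norm_of_nonneg (by positivity)]
  exact mul_le_of_le_one_right (sq_nonneg x) (min_le_left _ _)

lemma integral_sq_mul_min_mono {μ : Measure ℝ} (hμ : MemLp id 2 μ) {s t : ℝ} (h : |s| ≤ |t|) :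
    ∫ x, x ^ 2 * min 1 |s * x| ∂μ ≤ ∫ x, x ^ 2 * min 1 |t * x| ∂μ := by
  refine integral_mono (integrable_sq_mul_min hμ s) (integrable_sq_mul_min hμ t) fun x => ?_
  simp only [abs_mul]
  gcongr

lemma tendsto_integral_sq_mul_min_nhds_zero {μ : Measure ℝ} (hμ : MemLp id 2 μ) :
    Tendsto (fun s : ℝ => ∫ x, x ^ 2 * min 1 |s * x| ∂μ) (𝓝 0) (𝓝 0) := by
  have hcont : Continuous fun s : ℝ => ∫ x, x ^ 2 * min 1 |s * x| ∂μ := by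
    refine continuous_of_dominated (bound := fun x => x ^ 2) (fun s => by fun_prop)
      (fun s => ae_of_all _ fun x => ?_) hμ.integrable_sq (ae_of_all _ fun x => by fun_prop)
    rw [Real.norm_of_nonneg (by positivity)]
    exact mul_le_of_le_one_right (sq_nonneg x) (min_le_left _ _)
  simpa using hcont.tendsto 0

lemma norm_charFun_sub_taylor_two_le {μ : Measure ℝ} [IsProbabilityMeasure μ]
    (hμ : MemLp id 2 μ) (s : ℝ) :
    ‖charFun μ s - (1 + s * (∫ x, x ∂μ : ℝ) * Complex.I - (s : ℂ) ^ 2 / 2 * (∫ x, x ^ 2 ∂μ : ℝ))‖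
      ≤ 4 * s ^ 2 * ∫ x, x ^ 2 * min 1 |s * x| ∂μ := by
  have hexp : Integrable (fun x : ℝ => Complex.exp (s * x * Complex.I)) μ :=
    .of_bound (C := 1) (by fun_prop) <| ae_of_all _ fun x => by
      exact_mod_cast (Complex.norm_exp_ofReal_mul_I (s * x)).le
  have hone : Integrable (fun _ : ℝ => (1 : ℂ)) μ := integrable_const _
  have hlin : Integrable (fun x : ℝ => s * (x : ℂ) * Complex.I) μ :=
    (((hμ.integrable one_le_two).ofReal).const_mul _).mul_const _
  have hquad : Integrable (fun x : ℝ => (s : ℂ) ^ 2 / 2 * ((x ^ 2 : ℝ) : ℂ)) μ :=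
    (hμ.integrable_sq.ofReal).const_mul _
  have hremainder : charFun μ s
      - (1 + s * (∫ x, x ∂μ : ℝ) * Complex.I - (s : ℂ) ^ 2 / 2 * (∫ x, x ^ 2 ∂μ : ℝ))
      = ∫ x : ℝ, (Complex.exp (s * x * Complex.I)
        - (1 + s * x * Complex.I - (s : ℂ) ^ 2 / 2 * ((x ^ 2 : ℝ) : ℂ))) ∂μ := by
    have haffine : Integrable (fun x : ℝ => 1 + s * (x : ℂ) * Complex.I) μ := hone.add hlin
    have hpoly : Integrable (fun x : ℝ =>
        1 + s * (x : ℂ) * Complex.I - (s : ℂ) ^ 2 / 2 * ((x ^ 2 : ℝ) : ℂ)) μ := haffine.sub hquad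
    rw [integral_sub hexp hpoly, integral_sub haffine hquad,
      integral_add hone hlin, integral_mul_const, integral_const_mul, integral_const_mul,
      integral_complex_ofReal, integral_complex_ofReal, charFun_apply_real]
    simp
  rw [hremainder, ← integral_const_mul]
  refine norm_integral_le_of_norm_le ((integrable_sq_mul_min hμ s).const_mul _)
    (ae_of_all _ fun x => ?_)
  convert norm_exp_mul_I_sub_taylor_two_le (s * x) using 1
  · push_cast
    ring_nf
  · ring

variable {ι : Type*} {l : Filter ι} {μ : ι → ProbabilityMeasure ℝ} {ν : ProbabilityMeasure ℝ}

lemma tendsto_integral_sq_mul_min (hμ : ∀ i, MemLp id 2 (μ i : Measure ℝ))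
    (hν : MemLp id 2 (ν : Measure ℝ)) (h : Tendsto μ l (𝓝 ν))
    (hsq : Tendsto (fun i => ∫ x, x ^ 2 ∂(μ i : Measure ℝ)) l (𝓝 (∫ x, x ^ 2 ∂(ν : Measure ℝ))))
    (s : ℝ) :
    Tendsto (fun i => ∫ x, x ^ 2 * min 1 |s * x| ∂(μ i : Measure ℝ)) l
      (𝓝 (∫ x, x ^ 2 * min 1 |s * x| ∂(ν : Measure ℝ))) := by
  rcases eq_or_ne s 0 with rfl | hs
  · simpa using tendsto_const_nhds
  have hbound (x : ℝ) : ‖x ^ 2 - x ^ 2 * min 1 |s * x|‖ ≤ (s ^ 2)⁻¹ := by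
    rcases le_total 1 |s * x| with hx | hx
    · rw [min_eq_left hx, mul_one, sub_self, norm_zero]
      positivity
    · rw [Real.norm_of_nonneg
        (sub_nonneg.2 (mul_le_of_le_one_right (sq_nonneg x) (min_le_left _ _)))]
      have hsx : x ^ 2 * s ^ 2 ≤ 1 := by
        rw [← mul_pow, mul_comm, ← sq_abs]
        exact pow_le_one₀ (abs_nonneg _) hx
      calc x ^ 2 - x ^ 2 * min 1 |s * x| ≤ x ^ 2 := sub_le_self _ (by positivity)
        _ ≤ (s ^ 2)⁻¹ := by rwa [← one_div, le_div_iff₀ (by positivity)]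
  let f : BoundedContinuousFunction ℝ ℝ :=
    .ofNormedAddCommGroup (fun x => x ^ 2 - x ^ 2 * min 1 |s * x|) (by fun_prop) _ hbound
  have hf := ProbabilityMeasure.tendsto_iff_forall_integral_tendsto.1 h f
  have hsplit (ρ : Measure ℝ) (hρ : MemLp id 2 ρ) :
      ∫ x, x ^ 2 * min 1 |s * x| ∂ρ = ∫ x, x ^ 2 ∂ρ - ∫ x, f x ∂ρ := by
    have hρ2 : Integrable (fun x : ℝ => x ^ 2) ρ := hρ.integrable_sq
    simp only [f, BoundedContinuousFunction.coe_ofNormedAddCommGroup]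
    rw [integral_sub hρ2 (integrable_sq_mul_min hρ s), sub_sub_cancel]
  simp_rw [hsplit _ (hμ _), hsplit _ hν]
  exact hsq.sub hf

lemma tendsto_integral_sq_mul_min_zero (hμ : ∀ i, MemLp id 2 (μ i : Measure ℝ))
    (hν : MemLp id 2 (ν : Measure ℝ)) (h : Tendsto μ l (𝓝 ν))
    (hsq : Tendsto (fun i => ∫ x, x ^ 2 ∂(μ i : Measure ℝ)) l (𝓝 (∫ x, x ^ 2 ∂(ν : Measure ℝ))))
    {s : ι → ℝ} (hs : Tendsto s l (𝓝 0)) :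
    Tendsto (fun i => ∫ x, x ^ 2 * min 1 |s i * x| ∂(μ i : Measure ℝ)) l (𝓝 0) := by
  refine tendsto_order.2 ⟨fun a ha => .of_forall fun i =>
    ha.trans_le (integral_nonneg fun x => by positivity), fun ε hε => ?_⟩
  obtain ⟨δ, hδε, hδ⟩ :=
    (((tendsto_integral_sq_mul_min_nhds_zero hν).eventually_lt_const hε).filter_mono
      nhdsWithin_le_nhds |>.and (self_mem_nhdsWithin (s := Set.Ioi (0 : ℝ)))).exists
  filter_upwards [(tendsto_integral_sq_mul_min hμ hν h hsq δ).eventually_lt_const hδε,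
    hs.abs.eventually_lt_const (u := |δ|) (by simpa using (Set.mem_Ioi.1 hδ).ne')] with i hi hsi
  exact (integral_sq_mul_min_mono (hμ i) hsi.le).trans_lt hi

end SecondMoment

lemma tendsto_charFun_inv_sqrt_mul_pow_of_tendsto {μ : ℕ → ProbabilityMeasure ℝ}
    {ν : ProbabilityMeasure ℝ} (hμ : ∀ d, MemLp id 2 (μ d : Measure ℝ))
    (hν : MemLp id 2 (ν : Measure ℝ)) (hmean : ∀ d, ∫ x, x ∂(μ d : Measure ℝ) = 0)
    (h : Tendsto μ atTop (𝓝 ν))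
    (hsq : Tendsto (fun d => ∫ x, x ^ 2 ∂(μ d : Measure ℝ)) atTop
      (𝓝 (∫ x, x ^ 2 ∂(ν : Measure ℝ)))) (t : ℝ) :
    Tendsto (fun d : ℕ => charFun (μ d : Measure ℝ) ((√d)⁻¹ * t) ^ d) atTop
      (𝓝 (Complex.exp (-((∫ x, x ^ 2 ∂(ν : Measure ℝ) : ℝ) * (t : ℂ) ^ 2 / 2)))) := by
  have hscale : Tendsto (fun d : ℕ => (√(d : ℝ))⁻¹ * t) atTop (𝓝 0) := by
    simpa using (tendsto_inv_atTop_zero.comp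
      (Real.tendsto_sqrt_atTop.comp tendsto_natCast_atTop_atTop)).mul_const t
  have hscale_sq {d : ℕ} (hd : d ≠ 0) : (d : ℝ) * ((√d)⁻¹ * t) ^ 2 = t ^ 2 := by
    rw [mul_pow, inv_pow, Real.sq_sqrt (Nat.cast_nonneg d), mul_inv_cancel_left₀ (by positivity)]
  have hremainder : Tendsto (fun d : ℕ => (d : ℂ) * (charFun (μ d : Measure ℝ) ((√d)⁻¹ * t)
      - (1 - (((√d)⁻¹ * t : ℝ) : ℂ) ^ 2 / 2 * (∫ x, x ^ 2 ∂(μ d : Measure ℝ) : ℝ)))) atTop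
      (𝓝 0) := by
    have hbound := (tendsto_integral_sq_mul_min_zero hμ hν h hsq hscale).const_mul (4 * t ^ 2)
    rw [mul_zero] at hbound
    refine squeeze_zero_norm' ?_ hbound
    filter_upwards [eventually_ne_atTop 0] with d hd
    have htaylor := norm_charFun_sub_taylor_two_le (hμ d) ((√d)⁻¹ * t)
    simp only [hmean, Complex.ofReal_zero, mul_zero, zero_mul, add_zero] at htaylor
    rw [norm_mul, Complex.norm_natCast, ← hscale_sq hd]
    exact (mul_le_mul_of_nonneg_left htaylor (Nat.cast_nonneg d)).trans_eq (by ring)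
  have hquad : Tendsto (fun d : ℕ => -((∫ x, x ^ 2 ∂(μ d : Measure ℝ) : ℝ) * (t : ℂ) ^ 2 / 2))
      atTop (𝓝 (-((∫ x, x ^ 2 ∂(ν : Measure ℝ) : ℝ) * (t : ℂ) ^ 2 / 2))) :=
    ((((Complex.continuous_ofReal.tendsto _).comp hsq).mul_const _).div_const 2).neg
  have hlim : Tendsto (fun d : ℕ => (d : ℂ) * (charFun (μ d : Measure ℝ) ((√d)⁻¹ * t) - 1)) atTop
      (𝓝 (-((∫ x, x ^ 2 ∂(ν : Measure ℝ) : ℝ) * (t : ℂ) ^ 2 / 2))) := by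
    rw [← zero_add (-_ : ℂ)]
    refine (hremainder.add hquad).congr' ?_
    filter_upwards [eventually_ne_atTop 0] with d hd
    rw [← Complex.ofReal_pow t, ← hscale_sq hd]
    push_cast
    ring
  simpa using Complex.tendsto_one_add_pow_exp_of_tendsto hlim

section TriangularArray

variable {Ω : ℕ → Type*} {mΩ : ∀ d, MeasurableSpace (Ω d)} {P : ∀ d, Measure (Ω d)}
  [∀ d, IsProbabilityMeasure (P d)] {Ω' Ω'' : Type*} {mΩ' : MeasurableSpace Ω'}
  {mΩ'' : MeasurableSpace Ω''} {P' : Measure Ω'} [IsProbabilityMeasure P'] {P'' : Measure Ω''}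
  [IsProbabilityMeasure P''] {X : ∀ d, ℕ → Ω d → ℝ} {Z : Ω' → ℝ} {Y : Ω'' → ℝ} {v : NNReal}

theorem tendstoInDistribution_inv_sqrt_mul_sum_of_array
    (hindep : ∀ d, iIndepFun (X d) (P d))
    (hident : ∀ d j, IdentDistrib (X d j) (X d 0) (P d) (P d))
    (hX : ∀ d, MemLp (X d 0) 2 (P d)) (hmean : ∀ d, ∫ ω, X d 0 ω ∂(P d) = 0)
    (hlaw : TendstoInDistribution (fun d => X d 0) atTop Z P P') (hZ : MemLp Z 2 P')
    (hsq : Tendsto (fun d => ∫ ω, X d 0 ω ^ 2 ∂(P d)) atTop (𝓝 v))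
    (hv : ∫ ω, Z ω ^ 2 ∂P' = v) (hY : HasLaw Y (gaussianReal 0 v) P'') :
    TendstoInDistribution (fun (d : ℕ) ω => (√(d : ℝ))⁻¹ * ∑ j ∈ Finset.range d, X d j ω)
      atTop Y P P'' where
  forall_aemeasurable d :=
    (Finset.aemeasurable_fun_sum _ fun j _ => (hident d j).aemeasurable_fst).const_mul _
  tendsto := by
    have hmap (d : ℕ) : MemLp id 2 ((P d).map (X d 0)) :=
      (memLp_map_measure_iff aestronglyMeasurable_id (hX d).aemeasurable).2 (hX d)
    have hmap' : MemLp id 2 (P'.map Z) :=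
      (memLp_map_measure_iff aestronglyMeasurable_id hZ.aemeasurable).2 hZ
    have hint (d : ℕ) : ∫ x, x ∂((P d).map (X d 0)) = 0 := by
      rw [integral_map (hX d).aemeasurable (by fun_prop), hmean]
    have hint_sq (d : ℕ) :
        ∫ x, x ^ 2 ∂((P d).map (X d 0)) = ∫ ω, X d 0 ω ^ 2 ∂(P d) :=
      integral_map (hX d).aemeasurable (by fun_prop)
    have hlimit_sq : ∫ x, x ^ 2 ∂(P'.map Z) = v := by
      rw [integral_map hZ.aemeasurable (by fun_prop), hv]
    refine ProbabilityMeasure.tendsto_iff_tendsto_charFun.2 fun t => ?_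
    have hchar := tendsto_charFun_inv_sqrt_mul_pow_of_tendsto
      (μ := fun d => ⟨_, Measure.isProbabilityMeasure_map (hX d).aemeasurable⟩)
      (ν := ⟨_, Measure.isProbabilityMeasure_map hZ.aemeasurable⟩) hmap hmap' hint hlaw.tendsto
      (by simpa only [ProbabilityMeasure.coe_mk, hint_sq, hlimit_sq] using hsq) t
    simp only [ProbabilityMeasure.coe_mk, hlimit_sq] at hchar
    simpa [charFun_inv_sqrt_mul_sum (hindep _) (hident _), hY.map_eq, charFun_gaussianReal]
      using hchar

end TriangularArray

section Moments

variable {Ω : Type*} {mΩ : MeasurableSpace Ω} {P : Measure Ω} {X Y : Ω → ℝ}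

lemma integrable_pow_of_memLp [IsFiniteMeasure P] {p : ℕ} (hX : MemLp X p P) {k : ℕ}
    (hk : k ≤ p) : Integrable (fun ω => X ω ^ k) P := by
  have hXk : MemLp X k P := hX.mono_exponent (by exact_mod_cast hk)
  exact hXk.integrable_norm_pow'.mono' (hXk.aestronglyMeasurable.pow k)
    (ae_of_all _ fun ω => (norm_pow _ _).le)

lemma memLp_of_integrable_pow {p : ℕ} (hp : p ≠ 0) (hX : AEStronglyMeasurable X P)
    (h : Integrable (fun ω => X ω ^ p) P) : MemLp X p P := by
  rw [← integrable_norm_rpow_iff hX (by exact_mod_cast hp) (ENNReal.natCast_ne_top p)]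
  simpa [Real.rpow_natCast] using h.norm

lemma integral_add_pow_four_of_indepFun [IsProbabilityMeasure P] (h : X ⟂ᵢ[P] Y)
    (hX : MemLp X 4 P) (hY : MemLp Y 4 P) (hX0 : ∫ ω, X ω ∂P = 0) (hY0 : ∫ ω, Y ω ∂P = 0) :
    ∫ ω, (X ω + Y ω) ^ 4 ∂P = ∫ ω, X ω ^ 4 ∂P
      + 6 * ((∫ ω, X ω ^ 2 ∂P) * ∫ ω, Y ω ^ 2 ∂P) + ∫ ω, Y ω ^ 4 ∂P := by
  have hpow (j k : ℕ) : (fun ω => X ω ^ j) ⟂ᵢ[P] fun ω => Y ω ^ k :=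
    h.comp (φ := (· ^ j)) (ψ := (· ^ k)) (by fun_prop) (by fun_prop)
  have hmul (j k : ℕ) : ∫ ω, X ω ^ j * Y ω ^ k ∂P = (∫ ω, X ω ^ j ∂P) * ∫ ω, Y ω ^ k ∂P :=
    (hpow j k).integral_mul_eq_mul_integral (hX.aestronglyMeasurable.pow j)
      (hY.aestronglyMeasurable.pow k)
  simp_rw [add_pow]
  rw [integral_finsetSum]
  · simp_rw [integral_mul_const, hmul]
    simp only [Finset.sum_range_succ, Finset.range_zero, Finset.sum_empty]
    simp [Nat.choose, hX0, hY0]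
    ring
  · intro k hk
    exact ((hpow k (4 - k)).integrable_mul
      (integrable_pow_of_memLp (p := 4) hX (Finset.mem_range_succ_iff.1 hk))
      (integrable_pow_of_memLp (p := 4) hY (Nat.sub_le 4 k))).mul_const _

/-- The fourth cumulant `κ₄(X) = E (X - E X) ^ 4 - 3 Var(X) ^ 2` of a real random variable. It
measures how far `X ^ 2` is from having the variance it has for a Gaussian `X`. -/
noncomputable def fourthCumulant (X : Ω → ℝ) (P : Measure Ω) : ℝ :=
  centralMoment X 4 P - 3 * Var[X; P] ^ 2

lemma fourthCumulant_of_integral_eq_zero (hX : AEMeasurable X P) (h0 : ∫ ω, X ω ∂P = 0) :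
    fourthCumulant X P = ∫ ω, X ω ^ 4 ∂P - 3 * (∫ ω, X ω ^ 2 ∂P) ^ 2 := by
  simp [fourthCumulant, centralMoment, variance_of_integral_eq_zero hX h0, h0]

lemma fourthCumulant_const_mul (c : ℝ) (X : Ω → ℝ) :
    fourthCumulant (fun ω => c * X ω) P = c ^ 4 * fourthCumulant X P := by
  simp only [fourthCumulant, centralMoment, variance_const_mul, Pi.pow_apply, Pi.sub_apply,
    integral_const_mul, ← mul_sub, mul_pow]
  ring

lemma fourthCumulant_eq_of_identDistrib {Ω' : Type*} {mΩ' : MeasurableSpace Ω'} {P' : Measure Ω'}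
    {Y : Ω' → ℝ} (h : IdentDistrib X Y P P') : fourthCumulant X P = fourthCumulant Y P' := by
  have hcentral : centralMoment X 4 P = centralMoment Y 4 P' := by
    simp only [centralMoment, h.integral_eq]
    exact (h.comp (u := fun x => (x - ∫ ω, Y ω ∂P') ^ 4) (by fun_prop)).integral_eq
  rw [fourthCumulant, fourthCumulant, hcentral, h.variance_eq]

lemma fourthCumulant_add_of_indepFun [IsProbabilityMeasure P] (h : X ⟂ᵢ[P] Y)
    (hX : MemLp X 4 P) (hY : MemLp Y 4 P) :
    fourthCumulant (X + Y) P = fourthCumulant X P + fourthCumulant Y P := by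
  have hX1 : Integrable X P := hX.integrable (by norm_num)
  have hY1 : Integrable Y P := hY.integrable (by norm_num)
  have hcenter {Z : Ω → ℝ} (hZ : Integrable Z P) : ∫ ω, (Z ω - P[Z]) ∂P = 0 := by
    simp [integral_sub hZ (integrable_const _)]
  have hindep : (fun ω => X ω - P[X]) ⟂ᵢ[P] fun ω => Y ω - P[Y] :=
    h.comp (φ := (· - ∫ ω, X ω ∂P)) (ψ := (· - ∫ ω, Y ω ∂P)) (by fun_prop) (by fun_prop)
  have hcentral := integral_add_pow_four_of_indepFun hindep
    (hX.sub (memLp_const _)) (hY.sub (memLp_const _)) (hcenter hX1) (hcenter hY1)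
  simp only [← variance_eq_integral hX.aemeasurable,
    ← variance_eq_integral hY.aemeasurable] at hcentral
  simp only [fourthCumulant, centralMoment, Pi.pow_apply, Pi.sub_apply, Pi.add_apply,
    integral_add hX1 hY1, add_sub_add_comm, hcentral,
    h.variance_add (hX.mono_exponent (by norm_num)) (hY.mono_exponent (by norm_num))]
  ring

lemma fourthCumulant_sum_of_iIndepFun [IsProbabilityMeasure P] {ι : Type*} {X : ι → Ω → ℝ}
    (h : iIndepFun X P) (hX : ∀ i, MemLp (X i) 4 P) (s : Finset ι) :
    fourthCumulant (∑ i ∈ s, X i) P = ∑ i ∈ s, fourthCumulant (X i) P := by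
  classical
  induction s using Finset.induction_on with
  | empty => simp [fourthCumulant, centralMoment]
  | insert i s hi ih =>
    rw [Finset.sum_insert hi, Finset.sum_insert hi, ← ih]
    exact fourthCumulant_add_of_indepFun
      (h.indepFun_finsetSum_of_notMem₀ (fun i => (hX i).aemeasurable) hi).symm
      (hX i) (memLp_finsetSum' s fun i _ => hX i)

lemma fourthCumulant_id_gaussianReal (v : NNReal) : fourthCumulant id (gaussianReal 0 v) = 0 := by
  let γ := gaussianReal 0 v
  have hfst : IdentDistrib Prod.fst id (γ.prod γ) γ :=
    ⟨by fun_prop, by fun_prop, by simp [Measure.map_fst_prod]⟩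
  have hsnd : IdentDistrib Prod.snd id (γ.prod γ) γ :=
    ⟨by fun_prop, by fun_prop, by simp [Measure.map_snd_prod]⟩
  have hindep : Prod.fst ⟂ᵢ[γ.prod γ] (Prod.snd : ℝ × ℝ → ℝ) :=
    indepFun_prod (X := id) (Y := id) measurable_id measurable_id
  have hstable : IdentDistrib (Prod.fst + Prod.snd) (fun x => √2 * id x) (γ.prod γ) γ := by
    refine ⟨by fun_prop, by fun_prop, ?_⟩
    rw [gaussianReal_add_gaussianReal_of_indepFun hindep
      (hfst.map_eq.trans Measure.map_id) (hsnd.map_eq.trans Measure.map_id)]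
    refine Eq.trans ?_ (gaussianReal_map_const_mul √2).symm
    congr 1
    · simp
    · ext
      simp
      ring
  have hL4 : MemLp id 4 γ := memLp_id_gaussianReal' 4 (by norm_num)
  have hscale : 2 * fourthCumulant id γ = 4 * fourthCumulant id γ := by
    calc 2 * fourthCumulant id γ = fourthCumulant (Prod.fst + Prod.snd) (γ.prod γ) := by
          rw [fourthCumulant_add_of_indepFun hindep (hfst.memLp_iff.2 hL4) (hsnd.memLp_iff.2 hL4),
            fourthCumulant_eq_of_identDistrib hfst, fourthCumulant_eq_of_identDistrib hsnd, two_mul]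
      _ = 4 * fourthCumulant id γ := by
          rw [fourthCumulant_eq_of_identDistrib hstable, fourthCumulant_const_mul,
            show √(2 : ℝ) ^ 4 = (√2 ^ 2) ^ 2 by ring, Real.sq_sqrt zero_le_two]
          norm_num
  linarith

end Moments

section Curry

variable {Ω : Type*} {mΩ : MeasurableSpace Ω} {P : Measure Ω} {ι : Type*} {κ : ι → Type*}
  {𝓧 : (i : ι) → κ i → Type*} {m𝓧 : ∀ i j, MeasurableSpace (𝓧 i j)}

lemma iIndepFun_curry [Countable ι] [∀ i, Countable (κ i)] {X : (i : ι) → (j : κ i) → Ω → 𝓧 i j}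
    (hX : ∀ i j, AEMeasurable (X i j) P)
    (h : iIndepFun (fun (p : (i : ι) × κ i) ω => X p.1 p.2 ω) P) :
    iIndepFun (fun i ω => (X i · ω)) P := by
  have := h.isProbabilityMeasure
  have (i : ι) (j : κ i) : IsProbabilityMeasure (P.map (X i j)) :=
    Measure.isProbabilityMeasure_map (hX i j)
  have hblock (i : ι) : P.map (fun ω => (X i · ω)) = Measure.infinitePi fun j => P.map (X i j) :=
    (h.precomp (g := Sigma.mk i) sigma_mk_injective).map_fun_eq_infinitePi_map₀' (hX i)
  have hjoint := h.map_fun_eq_infinitePi_map₀' fun p => hX p.1 p.2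
  rw [iIndepFun_iff_map_fun_eq_infinitePi_map₀' fun i => aemeasurable_pi_iff.2 (hX i)]
  calc P.map (fun ω i j => X i j ω)
      = (P.map fun ω (p : (i : ι) × κ i) => X p.1 p.2 ω).map (MeasurableEquiv.piCurry 𝓧) := by
        rw [AEMeasurable.map_map_of_aemeasurable (by fun_prop)
          (aemeasurable_pi_iff.2 fun p : (i : ι) × κ i => hX p.1 p.2)]
        rfl
    _ = Measure.infinitePi fun i => Measure.infinitePi fun j => P.map (X i j) := by
        rw [hjoint, Measure.infinitePi_map_piCurry fun i j => P.map (X i j)]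
    _ = Measure.infinitePi fun i => P.map (fun ω => (X i · ω)) := by simp_rw [hblock]

lemma iIndepFun_columns {ι' : Type*} {E : ι → ι' → Type*} {mE : ∀ i j, MeasurableSpace (E i j)}
    [Countable ι] [Countable ι'] {X : (i : ι) → (j : ι') → Ω → E i j}
    (hX : ∀ i j, AEMeasurable (X i j) P) (h : iIndepFun (fun p : ι × ι' => X p.1 p.2) P) :
    iIndepFun (fun j ω i => X i j ω) P :=
  iIndepFun_curry (X := fun j i => X i j) (fun j i => hX i j) <|
    h.precomp (g := fun p : (_ : ι') × ι => (p.2, p.1)) <| by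
      rintro ⟨j, i⟩ ⟨j', i'⟩ hij
      cases hij
      rfl

end Curry

/-- The square `x ^ 2`, centered and scaled so as to have mean `0` and variance `1` when `x` is
Gaussian of mean `0` and variance `v`. It is `0` for `v = 0`. -/
noncomputable def normalizedSquare (v x : ℝ) : ℝ :=
  (x ^ 2 - v) / (√2 * v)

section NormalizedSquare

@[fun_prop]
lemma continuous_normalizedSquare (v : ℝ) : Continuous (normalizedSquare v) := by
  unfold normalizedSquare
  fun_prop

lemma normalizedSquare_mul_left {c v : ℝ} (hc : c ≠ 0) (x : ℝ) :
    normalizedSquare (c ^ 2 * v) (c * x) = normalizedSquare v x := by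
  rw [normalizedSquare, normalizedSquare, mul_pow, ← mul_sub, mul_left_comm,
    mul_div_mul_left _ _ (pow_ne_zero 2 hc)]

variable {Ω : Type*} {mΩ : MeasurableSpace Ω} {P : Measure Ω} [IsProbabilityMeasure P]
  {S : Ω → ℝ} {v : ℝ}

lemma memLp_two_normalizedSquare (hS : MemLp S 4 P) (v : ℝ) :
    MemLp (fun ω => normalizedSquare v (S ω)) 2 P := by
  have hsq : MemLp (fun ω => S ω ^ 2) 2 P := by
    refine (memLp_two_iff_integrable_sq (hS.aestronglyMeasurable.pow 2)).2 ?_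
    simpa [← pow_mul] using integrable_pow_of_memLp (p := 4) hS le_rfl
  simpa [normalizedSquare, div_eq_inv_mul] using (hsq.sub (memLp_const v)).const_mul (√2 * v)⁻¹

lemma integral_normalizedSquare (hS : MemLp S 2 P) (hv : ∫ ω, S ω ^ 2 ∂P = v) :
    ∫ ω, normalizedSquare v (S ω) ∂P = 0 := by
  simp [normalizedSquare, integral_div, integral_sub hS.integrable_sq (integrable_const v), hv]

lemma integral_normalizedSquare_sq (hS : MemLp S 4 P) (h0 : ∫ ω, S ω ∂P = 0)
    (hv : ∫ ω, S ω ^ 2 ∂P = v) (hv0 : v ≠ 0) :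
    ∫ ω, normalizedSquare v (S ω) ^ 2 ∂P = 1 + fourthCumulant S P / (2 * v ^ 2) := by
  have hS4 := integrable_pow_of_memLp (p := 4) hS le_rfl
  have hS2 := (integrable_pow_of_memLp (p := 4) hS (k := 2) (by norm_num)).const_mul (2 * v)
  have hS42 : Integrable (fun ω => S ω ^ 4 - 2 * v * S ω ^ 2) P := hS4.sub hS2
  have hexpand (x : ℝ) :
      normalizedSquare v x ^ 2 = (x ^ 4 - 2 * v * x ^ 2 + v ^ 2) / (2 * v ^ 2) := by
    rw [normalizedSquare, div_pow, mul_pow, Real.sq_sqrt zero_le_two]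
    ring
  simp_rw [hexpand]
  rw [integral_div, integral_add hS42 (integrable_const _), integral_sub hS4 hS2,
    integral_const_mul, hv, fourthCumulant_of_integral_eq_zero hS.aemeasurable h0, hv]
  simp only [integral_const, probReal_univ, one_smul]
  field_simp
  ring

lemma integral_normalizedSquare_sq_gaussianReal {v : NNReal} (hv : v ≠ 0) :
    ∫ x, normalizedSquare v x ^ 2 ∂(gaussianReal 0 v) = 1 := by
  have hmean : ∫ x, id x ∂(gaussianReal 0 v) = 0 := integral_id_gaussianReal
  have hsq : ∫ x, id x ^ 2 ∂(gaussianReal 0 v) = v :=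
    (variance_of_integral_eq_zero aemeasurable_id hmean).symm.trans variance_id_gaussianReal
  have hL4 : MemLp id 4 (gaussianReal 0 v) := memLp_id_gaussianReal' 4 (by norm_num)
  simpa [fourthCumulant_id_gaussianReal] using
    integral_normalizedSquare_sq hL4 hmean hsq (NNReal.coe_ne_zero.2 hv)

end NormalizedSquare

section Sums

variable {Ω : Type*} {mΩ : MeasurableSpace Ω} {P : Measure Ω}

lemma integral_sum_sq_of_iIndepFun {ι : Type*} {X : ι → Ω → ℝ} (hindep : iIndepFun X P)
    (hX : ∀ i, MemLp (X i) 2 P) (h0 : ∀ i, ∫ ω, X i ω ∂P = 0) (s : Finset ι) :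
    ∫ ω, (∑ i ∈ s, X i ω) ^ 2 ∂P = ∑ i ∈ s, ∫ ω, X i ω ^ 2 ∂P := by
  have := hindep.isProbabilityMeasure
  have hmean : ∫ ω, (∑ i ∈ s, X i) ω ∂P = 0 := by
    simp [integral_finsetSum _ fun i _ => (hX i).integrable one_le_two, h0]
  have hvar := IndepFun.variance_sum (s := s) (fun i _ => hX i)
    fun i _ j _ hij => hindep.indepFun hij
  simp_rw [variance_of_integral_eq_zero (hX _).aemeasurable (h0 _)] at hvar
  rw [variance_of_integral_eq_zero (s.aemeasurable_sum fun i _ => (hX i).aemeasurable) hmean]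
    at hvar
  simpa using hvar

variable {X : ℕ → Ω → ℝ}

lemma integral_sq_sum_range (hindep : iIndepFun X P)
    (hident : ∀ i, IdentDistrib (X i) (X 0) P P) (hX : MemLp (X 0) 2 P)
    (h0 : ∫ ω, X 0 ω ∂P = 0) (m : ℕ) :
    ∫ ω, (∑ i ∈ Finset.range m, X i ω) ^ 2 ∂P = m * ∫ ω, X 0 ω ^ 2 ∂P := by
  rw [integral_sum_sq_of_iIndepFun hindep (fun i => (hident i).memLp_iff.2 hX)
    fun i => (hident i).integral_eq.trans h0]
  simp [fun i => (hident i).sq.integral_eq]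

variable [IsProbabilityMeasure P]

lemma tendsto_integral_normalizedSquare_sum_sq (hindep : iIndepFun X P)
    (hident : ∀ i, IdentDistrib (X i) (X 0) P P) (hX : MemLp (X 0) 4 P)
    (h0 : ∫ ω, X 0 ω ∂P = 0) (h1 : ∫ ω, X 0 ω ^ 2 ∂P = 1) :
    Tendsto (fun m : ℕ => ∫ ω, normalizedSquare m (∑ i ∈ Finset.range m, X i ω) ^ 2 ∂P) atTop
      (𝓝 1) := by
  have hX' (i : ℕ) : MemLp (X i) 4 P := (hident i).memLp_iff.2 hX
  have h0' (i : ℕ) : ∫ ω, X i ω ∂P = 0 := (hident i).integral_eq.trans h0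
  have hvar (m : ℕ) : ∫ ω, (∑ i ∈ Finset.range m, X i ω) ^ 2 ∂P = m := by
    rw [integral_sq_sum_range hindep hident (hX.mono_exponent (by norm_num)) h0, h1, mul_one]
  have hcumulant (m : ℕ) : fourthCumulant (fun ω => ∑ i ∈ Finset.range m, X i ω) P
      = m * fourthCumulant (X 0) P := by
    simpa [← Finset.sum_fn, fourthCumulant_eq_of_identDistrib (hident _)] using
      fourthCumulant_sum_of_iIndepFun hindep hX' (Finset.range m)
  have hlim : Tendsto (fun m : ℕ => 1 + fourthCumulant (X 0) P / 2 * (m : ℝ)⁻¹) atTop (𝓝 1) := by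
    simpa using (tendsto_inv_atTop_nhds_zero_nat.const_mul (fourthCumulant (X 0) P / 2)).const_add 1
  refine hlim.congr' ?_
  filter_upwards [eventually_ne_atTop 0] with m hm
  have hm' : (m : ℝ) ≠ 0 := by exact_mod_cast hm
  rw [integral_normalizedSquare_sq (memLp_finsetSum _ fun i _ => hX' i) ?_ (hvar m) hm', hcumulant]
  · field_simp
  · simp [integral_finsetSum _ fun i _ => (hX' i).integrable (by norm_num), h0']

lemma tendstoInDistribution_normalizedSquare_sum (hindep : iIndepFun X P)
    (hident : ∀ i, IdentDistrib (X i) (X 0) P P)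
    (h0 : ∫ ω, X 0 ω ∂P = 0) (h1 : ∫ ω, X 0 ω ^ 2 ∂P = 1) :
    TendstoInDistribution (fun (m : ℕ) ω => normalizedSquare m (∑ i ∈ Finset.range m, X i ω)) atTop
      (normalizedSquare 1) (fun _ => P) (gaussianReal 0 1) := by
  have hX (i : ℕ) : AEMeasurable (X i) P := (hident i).aemeasurable_fst
  have hclt := (tendstoInDistribution_inv_sqrt_mul_sum (Y := id) HasLaw.id h0 h1 hindep
    hident).continuous_comp (continuous_normalizedSquare 1)
  refine ⟨fun m => by fun_prop, by fun_prop, hclt.tendsto.congr' ?_⟩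
  filter_upwards [eventually_ne_atTop 0] with m hm
  have hscale : ((√(m : ℝ))⁻¹) ^ 2 * m = 1 := by
    rw [inv_pow, Real.sq_sqrt m.cast_nonneg, inv_mul_cancel₀ (by exact_mod_cast hm)]
  refine Subtype.ext (congrArg P.map (funext fun ω => ?_))
  rw [Function.comp_apply, ← hscale, normalizedSquare_mul_left (by positivity)]

end Sums

section Walk

variable {Ω : Type*} (ξ : ℕ → ℕ → Ω → ℝ)

lemma norm_sq_walkPosition (d k : ℕ) (ω : Ω) :
    ‖walkPosition ξ d k ω‖ ^ 2 =
      (d : ℝ)⁻¹ * ∑ j ∈ Finset.range d, (∑ i ∈ Finset.range k, ξ i j ω) ^ 2 := by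
  have hcoord (j : Fin d) :
      walkPosition ξ d k ω j = (√(d : ℝ))⁻¹ * ∑ i ∈ Finset.range k, ξ i j ω := by
    simp [walkPosition, walkIncrement, Finset.mul_sum]
  simp_rw [EuclideanSpace.real_norm_sq_eq, hcoord, mul_pow, ← Finset.mul_sum, inv_pow,
    Real.sq_sqrt (Nat.cast_nonneg d)]
  rw [Finset.sum_range fun j => (∑ i ∈ Finset.range k, ξ i j ω) ^ 2]

lemma norm_sq_walkPosition_sub_div (d k : ℕ) (ω : Ω) :
    (‖walkPosition ξ d k ω‖ ^ 2 - (k : ℝ)) / √(2 * (k : ℝ) ^ 2 / (d : ℝ)) =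
      (√(d : ℝ))⁻¹ * ∑ j ∈ Finset.range d, normalizedSquare k (∑ i ∈ Finset.range k, ξ i j ω) := by
  rcases d.eq_zero_or_pos with rfl | hd
  · simp
  have hsqrt : √(2 * (k : ℝ) ^ 2 / (d : ℝ)) = √2 * k / √d := by
    rw [Real.sqrt_div (by positivity), Real.sqrt_mul zero_le_two, Real.sqrt_sq k.cast_nonneg]
  have hd' : √(d : ℝ) ≠ 0 := by positivity
  simp_rw [norm_sq_walkPosition, normalizedSquare, hsqrt, ← Finset.sum_div, Finset.sum_sub_distrib]
  rw [Finset.sum_const, Finset.card_range, nsmul_eq_mul, div_div_eq_mul_div, ← mul_div_assoc]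
  congr 1
  field_simp
  rw [Real.sq_sqrt d.cast_nonneg]
  field_simp

end Walk

section Columns

variable {Ω : Type*} {mΩ : MeasurableSpace Ω} {P : Measure Ω} [IsProbabilityMeasure P]
  {ξ : ℕ → ℕ → Ω → ℝ}

theorem tendstoInDistribution_inv_sqrt_mul_sum_normalizedSquare
    (hindep : iIndepFun (fun p : ℕ × ℕ => ξ p.1 p.2) P)
    (hident : ∀ i j, IdentDistrib (ξ i j) (ξ 0 0) P P) (hL4 : MemLp (ξ 0 0) 4 P)
    (h0 : ∫ ω, ξ 0 0 ω ∂P = 0) (h1 : ∫ ω, ξ 0 0 ω ^ 2 ∂P = 1) {n : ℕ → ℕ}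
    (hn : Tendsto n atTop atTop) :
    TendstoInDistribution (fun (d : ℕ) ω => (√(d : ℝ))⁻¹ *
        ∑ j ∈ Finset.range d, normalizedSquare (n d) (∑ i ∈ Finset.range (n d), ξ i j ω))
      atTop id (fun _ => P) (gaussianReal 0 1) := by
  have hmeas (i j : ℕ) : AEMeasurable (ξ i j) P := (hident i j).aemeasurable_fst
  have hcolumn (j : ℕ) : iIndepFun (fun i => ξ i j) P :=
    hindep.precomp (g := fun i => (i, j)) (Prod.mk_left_injective j)
  have hg (m : ℕ) : Measurable fun x : ℕ → ℝ =>
    normalizedSquare m (∑ i ∈ Finset.range m, x i) := by fun_prop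
  have hsum (m : ℕ) : MemLp (fun ω => ∑ i ∈ Finset.range m, ξ i 0 ω) 4 P :=
    memLp_finsetSum _ fun i _ => (hident i 0).memLp_iff.2 hL4
  have hvar (m : ℕ) : ∫ ω, (∑ i ∈ Finset.range m, ξ i 0 ω) ^ 2 ∂P = m := by
    rw [integral_sq_sum_range (hcolumn 0) (hident · 0) (hL4.mono_exponent (by norm_num)) h0, h1,
      mul_one]
  have hlaw := tendstoInDistribution_normalizedSquare_sum (hcolumn 0) (hident · 0) h0 h1
  have hsq := tendsto_integral_normalizedSquare_sum_sq (hcolumn 0) (hident · 0) hL4 h0 h1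
  exact tendstoInDistribution_inv_sqrt_mul_sum_of_array (P := fun _ => P) (v := 1)
    (X := fun d j ω => normalizedSquare (n d) (∑ i ∈ Finset.range (n d), ξ i j ω))
    (hindep := fun d => (iIndepFun_columns hmeas hindep).comp₀ _
      (fun j => aemeasurable_pi_iff.2 (hmeas · j)) fun _ => (hg (n d)).aemeasurable)
    (hident := fun d j => (IdentDistrib.pi (fun i => (hident i j).trans (hident i 0).symm)
      (hcolumn j) (hcolumn 0)).comp (hg (n d)))
    (hX := fun d => memLp_two_normalizedSquare (hsum (n d)) (n d))
    (hmean := fun d =>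
      integral_normalizedSquare ((hsum (n d)).mono_exponent (by norm_num)) (hvar (n d)))
    (hlaw := ⟨fun d => hlaw.forall_aemeasurable (n d), hlaw.aemeasurable_limit,
      hlaw.tendsto.comp hn⟩)
    (hZ := memLp_two_normalizedSquare (memLp_id_gaussianReal' 4 (by norm_num)) 1)
    (hsq := hsq.comp hn)
    (hv := by simpa using integral_normalizedSquare_sq_gaussianReal one_ne_zero)
    (hY := HasLaw.id)

end Columns

theorem mainTheorem7
    {Ω Ω' : Type*} [MeasurableSpace Ω] [MeasurableSpace Ω']
    (P : Measure Ω) [IsProbabilityMeasure P] (P' : Measure Ω') [IsProbabilityMeasure P']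
    (ξ₀ : Ω' → ℝ)
    (hmean : ∫ ω, ξ₀ ω ∂P' = 0)
    (hvar : ∫ ω, ξ₀ ω ^ 2 ∂P' = 1)
    (hfourth : Integrable (fun ω => ξ₀ ω ^ 4) P')
    (ξ : ℕ → ℕ → Ω → ℝ)
    (hindep : iIndepFun (fun p : ℕ × ℕ => ξ p.1 p.2) P)
    (hcopies : ∀ i j, IdentDistrib (ξ i j) ξ₀ P P')
    (n : ℕ → ℕ) (hn : Tendsto n atTop atTop) :
    TendstoInDistribution
      (fun (d : ℕ) (ω : Ω) =>
        (‖walkPosition ξ d (n d) ω‖ ^ 2 - (n d : ℝ)) / √(2 * (n d : ℝ) ^ 2 / (d : ℝ)))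
      atTop (id : ℝ → ℝ) (fun _ => P) (gaussianReal 0 1) := by
  have hξ₀ : MemLp ξ₀ 4 P' := memLp_of_integrable_pow (p := 4) (by norm_num)
    (hcopies 0 0).aemeasurable_snd.aestronglyMeasurable hfourth
  simp_rw [norm_sq_walkPosition_sub_div]
  exact tendstoInDistribution_inv_sqrt_mul_sum_normalizedSquare hindep
    (fun i j => (hcopies i j).trans (hcopies 0 0).symm) ((hcopies 0 0).memLp_iff.2 hξ₀)
    ((hcopies 0 0).integral_eq.trans hmean) ((hcopies 0 0).sq.integral_eq.trans hvar) hn
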